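/- Terms are first-order terms over a signature $\mathcal{F}$ (a set of function symbols, each with a fixed arity) and a countably infinite set $\mathcal{V}$ of variables; a term is ground if it contains no variables. A rewrite rule $\ell \to r$ over $\mathcal{F}$ is a pair of terms over $\mathcal{F}$ and $\mathcal{V}$ such that $\ell$ is not a variable and every variable of $r$ occurs in $\ell$. A term rewrite system (TRS) consists of a signature and a set of rewrite rules over it; its rewrite relation $\to$, on the terms over its signature and $\mathcal{V}$, is the closure of its rules under substitutions and contexts. It is confluent if, for all terms $s, t, u$ over its signature with $s \to^* t$ and $s \to^* u$, there is a term $w$ with $t \to^* w$ and $u \to^* w$. Let $\mathcal{R}_1$ and $\mathcal{R}_2$ be TRSs over signatures $\mathcal{F}_1$ and $\mathcal{F}_2$, where each symbol in $\mathcal{F}_1 \cap \mathcal{F}_2$ (a shared symbol) has the same arity in both. Let $\mathcal{R} = \mathcal{R}_1 \cup \mathcal{R}_2$, a TRS over the signature $\mathcal{F}_1 \cup \mathcal{F}_2$. A term over $\mathcal{F}_1 \cup \mathcal{F}_2$ and $\mathcal{V}$ is called quasi-ground if each of its subterms whose root is a shared symbol is ground. Theorem. Suppose that for every rule $\ell \to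 r$ in $\mathcal{R}$ the root of $\ell$ is not in $\mathcal{F}_1 \cap \mathcal{F}_2$, and both $\ell$ and $r$ are quasi-ground. If $\mathcal{R}_1$ and $\mathcal{R}_2$ are confluent, then $\mathcal{R}$ is confluent. -/

import Mathlib

/-!
First-order term rewriting. The function symbols, each with a fixed arity, are those of a
first-order language `L` (its relation symbols play no role); a signature is a set of them.
-/

namespace Rewriting

open FirstOrder FirstOrder.Language

universe u v w

variable {L : FirstOrder.Language.{u, v}} {V : Type w}

/-- Function symbols: pairs of an arity `n` and an `n`-ary function symbol of `L`. -/
abbrev Symbol (L : FirstOrder.Language.{u, v}) : Type u := Σ n, L.Functions n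

/-- The set of variables that occur in a term. -/
def vars : L.Term V → Set V
  | .var x => {x}
  | .func _ ts => ⋃ i, vars (ts i)

/-- The set of function symbols that occur in a term. -/
def funs : L.Term V → Set (Symbol L)
  | .var _ => ∅
  | .func (l := n) f ts => insert ⟨n, f⟩ (⋃ i, funs (ts i))

/-- The set of terms over the signature `F` and the variables `V`. -/
def termsOver (V : Type w) (F : Set (Symbol L)) : Set (L.Term V) :=
  {t | funs t ⊆ F}

/-- The set of ground terms over the signature `F`. -/
def groundTerms (V : Type w) (F : Set (Symbol L)) : Set (L.Term V) :=
  {t | t ∈ termsOver V F ∧ vars t = ∅}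

/-- The root of the term is a function symbol from `S` (so the term is not a variable). -/
def RootIn (S : Set (Symbol L)) : L.Term V → Prop
  | .var _ => False
  | .func (l := n) f _ => (⟨n, f⟩ : Symbol L) ∈ S

/-- `Subterm s t`: the term `s` is `t` itself or a proper subterm of `t`, that is, `s` is the
subterm of `t` at some position of `t`. -/
inductive Subterm : L.Term V → L.Term V → Prop
  | refl (t : L.Term V) : Subterm t t
  | arg {s : L.Term V} {n : ℕ} (f : L.Functions n) (ts : Fin n → L.Term V) (i : Fin n)
      (h : Subterm s (ts i)) : Subterm s (.func f ts)

/-- A rewrite rule over the signature `F`: a pair of terms over `F` whose left-hand side is not a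
variable and contains every variable of the right-hand side. -/
structure IsRule (F : Set (Symbol L)) (lhs rhs : L.Term V) : Prop where
  lhs_mem : lhs ∈ termsOver V F
  rhs_mem : rhs ∈ termsOver V F
  lhs_ne_var : ∀ x : V, lhs ≠ .var x
  vars_subset : vars rhs ⊆ vars lhs

/-- A term rewrite system (TRS): a signature and a (possibly infinite) set of rewrite rules
over it. -/
structure TRS (L : FirstOrder.Language.{u, v}) (V : Type w) where
  sig : Set (Symbol L)
  rules : Set (L.Term V × L.Term V)
  isRule : ∀ ρ ∈ rules, IsRule sig ρ.1 ρ.2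

theorem IsRule.mono {F G : Set (Symbol L)} (h : F ⊆ G) {l r : L.Term V} (hr : IsRule F l r) :
    IsRule G l r :=
  ⟨fun _ hx => h (hr.lhs_mem hx), fun _ hx => h (hr.rhs_mem hx), hr.lhs_ne_var, hr.vars_subset⟩

/-- The union of two TRSs: the union of the rules, over the union of the signatures. -/
instance : Union (TRS L V) where
  union R S :=
    { sig := R.sig ∪ S.sig
      rules := R.rules ∪ S.rules
      isRule := by
        rintro ρ (h | h)
        · exact (R.isRule ρ h).mono Set.subset_union_left
        · exact (S.isRule ρ h).mono Set.subset_union_right }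

/-- The rewrite relation of a set of rules: the closure of the rules under substitutions and
contexts. -/
inductive Step (rules : Set (L.Term V × L.Term V)) : L.Term V → L.Term V → Prop
  | root {l r : L.Term V} (h : (l, r) ∈ rules) (σ : V → L.Term V) :
      Step rules (l.subst σ) (r.subst σ)
  | arg {n : ℕ} (f : L.Functions n) (ts : Fin n → L.Term V) (i : Fin n) {t : L.Term V}
      (h : Step rules (ts i) t) :
      Step rules (.func f ts) (.func f (Function.update ts i t))

theorem funs_subst (t : L.Term V) (σ : V → L.Term V) :
    funs (t.subst σ) = funs t ∪ ⋃ x ∈ vars t, funs (σ x) := by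
  induction t with
  | var x => simp [Term.subst, funs, vars]
  | func f ts ih =>
    ext y
    simp only [Term.subst, funs, vars, ih, Set.mem_insert_iff, Set.mem_iUnion, Set.mem_union]
    grind

/-- The terms over the signature of a TRS are closed under its rewrite relation. -/
theorem Step.mem_termsOver (R : TRS L V) {s t : L.Term V} (h : Step R.rules s t)
    (hs : s ∈ termsOver V R.sig) : t ∈ termsOver V R.sig := by
  induction h with
  | root h σ =>
    have hr := R.isRule _ h
    simp only [termsOver, Set.mem_ofPred_eq, funs_subst, Set.union_subset_iff] at hs ⊢
    exact ⟨hr.rhs_mem, (Set.biUnion_subset_biUnion_left hr.vars_subset).trans hs.2⟩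
  | arg f ts i h ih =>
    simp only [termsOver, Set.mem_ofPred_eq, funs, Set.insert_subset_iff,
      Set.iUnion_subset_iff] at hs ih ⊢
    refine ⟨hs.1, fun j => ?_⟩
    by_cases hj : j = i
    · subst hj
      simpa using ih (hs.2 j)
    · simpa [hj] using hs.2 j

/-- A TRS is confluent if its rewrite relation on the terms over its own signature is confluent.
These terms are closed under rewriting, so only the start of a peak has to be restricted. -/
def TRS.Confluent (R : TRS L V) : Prop :=
  ∀ s ∈ termsOver V R.sig, ∀ t u : L.Term V,
    Relation.ReflTransGen (Step R.rules) s t → Relation.ReflTransGen (Step R.rules) s u →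
      ∃ w : L.Term V,
        Relation.ReflTransGen (Step R.rules) t w ∧ Relation.ReflTransGen (Step R.rules) u w

/-- A term is quasi-ground (with respect to two signatures `F₁` and `F₂`) if all its subterms
that are rooted in a shared function symbol are ground terms over `F₁ ∪ F₂`. -/
def QuasiGround (F₁ F₂ : Set (Symbol L)) (t : L.Term V) : Prop :=
  ∀ s : L.Term V, Subterm s t → RootIn (F₁ ∩ F₂) s → s ∈ groundTerms V (F₁ ∪ F₂)

end Rewriting

namespace Rewriting

open FirstOrder FirstOrder.Language Relation

universe u v w x y z

variable {L : FirstOrder.Language.{u, v}} {V : Type w} {X : Type x} {Y : Type y} {Z : Type z}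

/-! ### Substitutions -/

/-! Cut a term into a top layer over one signature `F`, in which every subterm rooted in a shared
symbol is ground, and the aliens below it. Both sides of a quasi-ground rule over `F` are layers
(`lay_of_quasiGround`), so a step takes place in the layer or inside one alien
(`Component.step_cases`). The difficulty is that an alien may rewrite to a term that fuses with the
layer above it.

Suppose first that no alien can ever fuse, and that aliens are confluent. Replace each alien by the
class of the terms joinable with it. Steps inside aliens vanish, layer steps remain steps of one
given system, and the confluence of that system closes the peak; classes are then instantiated by
common reducts (`Component.confluentAt_of_stable`). In general, aliens are first rewritten to
representatives whose own aliens are stable. A step between two terms makes their representatives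
joinable, and these are confluent by the first case (`Component.layered_confluent`).

Confluence of all terms follows by induction on the number of layers (`Component.rankClass_spec`).
Stable representatives persist: a term that has no layer over `F` on top is a stable alien, or it
has a reduct that is of lower rank or ground over `F` (`exists_stable_reduct`). -/

theorem subst_subst (t : L.Term X) (σ : X → L.Term Y) (τ : Y → L.Term Z) :
    (t.subst σ).subst τ = t.subst fun x => (σ x).subst τ := by
  induction t with
  | var x => rfl
  | func f ts ih => simp only [Term.subst, ih]

theorem subst_var (t : L.Term X) : t.subst .var = t := by
  induction t with
  | var x => rfl
  | func f ts ih => simp only [Term.subst, ih]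

theorem subst_congr {t : L.Term X} {σ τ : X → L.Term Y} (h : ∀ x ∈ vars t, σ x = τ x) :
    t.subst σ = t.subst τ := by
  induction t with
  | var x => exact h x rfl
  | func f ts ih =>
    simp only [Term.subst]
    congr 1
    funext i
    exact ih i fun x hx => h x (Set.mem_iUnion_of_mem i hx)

theorem vars_subst (t : L.Term X) (σ : X → L.Term Y) :
    vars (t.subst σ) = ⋃ x ∈ vars t, vars (σ x) := by
  induction t with
  | var x => simp [Term.subst, vars]
  | func f ts ih =>
    ext y
    simp only [Term.subst, vars, ih, Set.mem_iUnion]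
    grind

theorem vars_finite (t : L.Term X) : (vars t).Finite := by
  induction t with
  | var x => exact Set.finite_singleton x
  | func f ts ih => exact Set.finite_iUnion ih

theorem funs_relabel (t : L.Term X) (ρ : X → Y) :
    funs (t.subst fun x => .var (ρ x)) = funs t := by
  induction t with
  | var x => rfl
  | func f ts ih => simp only [Term.subst, funs, ih]

/-! ### Rewriting terms over an arbitrary set of variables -/

/-- The rewrite relation of a set of rules on terms whose variables need not be those of the
rules. -/
inductive GStep (P : Set (L.Term V × L.Term V)) : L.Term X → L.Term X → Prop
  | root {l r : L.Term V} (h : (l, r) ∈ P) (σ : V → L.Term X) :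
      GStep P (l.subst σ) (r.subst σ)
  | arg {n : ℕ} (f : L.Functions n) (ts : Fin n → L.Term X) (i : Fin n) {t : L.Term X}
      (h : GStep P (ts i) t) : GStep P (.func f ts) (.func f (Function.update ts i t))

variable {A P : Set (L.Term V × L.Term V)}

theorem subst_func_update {n : ℕ} (f : L.Functions n) (ts : Fin n → L.Term X) (i : Fin n)
    (t : L.Term X) (θ : X → L.Term Y) :
    (Term.func f (Function.update ts i t)).subst θ =
      .func f (Function.update (fun j => (ts j).subst θ) i (t.subst θ)) := by
  simp only [Term.subst]
  congr 1
  funext j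
  by_cases hj : j = i
  · subst hj; simp
  · simp [hj]

theorem GStep.subst {s t : L.Term X} (h : GStep A s t) (θ : X → L.Term Y) :
    GStep A (s.subst θ) (t.subst θ) := by
  induction h with
  | root h σ => simpa only [subst_subst] using GStep.root h _
  | arg f ts i h ih =>
    rw [subst_func_update]
    exact GStep.arg f (fun j => (ts j).subst θ) i ih

theorem GStep.step (hAP : A ⊆ P) {s t : L.Term V} (h : GStep A s t) : Step P s t := by
  induction h with
  | root h σ => exact .root (hAP h) σ
  | arg f ts i h ih => exact .arg f ts i ih

theorem Step.gstep {s t : L.Term V} (h : Step A s t) : GStep A s t := by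
  induction h with
  | root h σ => exact .root h σ
  | arg f ts i h ih => exact .arg f ts i ih

theorem GStep.vars_subset (hA : ∀ ρ ∈ A, vars ρ.2 ⊆ vars ρ.1) {s t : L.Term X}
    (h : GStep A s t) : vars t ⊆ vars s := by
  induction h with
  | root h σ =>
    rw [vars_subst, vars_subst]
    exact Set.biUnion_subset_biUnion_left (hA _ h)
  | arg f ts i h ih =>
    refine Set.iUnion_subset fun j x hx => ?_
    by_cases hj : j = i
    · subst hj
      exact Set.mem_iUnion_of_mem j (ih (by simpa using hx))
    · exact Set.mem_iUnion_of_mem j (by simpa [hj] using hx)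

theorem gstep_vars_subset_of_reflTransGen (hA : ∀ ρ ∈ A, vars ρ.2 ⊆ vars ρ.1) {s t : L.Term X}
    (h : ReflTransGen (GStep A) s t) : vars t ⊆ vars s := by
  induction h with
  | refl => exact subset_rfl
  | tail _ h ih => exact (h.vars_subset hA).trans ih

theorem gstep_reflTransGen_subst {s t : L.Term X} (h : ReflTransGen (GStep A) s t)
    (θ : X → L.Term Y) : ReflTransGen (GStep A) (s.subst θ) (t.subst θ) :=
  h.lift (fun q => q.subst θ) fun _ _ h => h.subst θ

theorem gstep_reflTransGen_step (hAP : A ⊆ P) {s t : L.Term V}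
    (h : ReflTransGen (GStep A) s t) : ReflTransGen (Step P) s t :=
  ReflTransGen.mono (fun _ _ h => h.step hAP) _ _ h

/-- Confluence over an infinite set of variables implies confluence over any set of variables. -/
theorem gstep_confluent [Infinite V] [Nonempty X] {R : TRS L V} (hR : R.Confluent)
    {s t u : L.Term X} (hs : funs s ⊆ R.sig) (ht : ReflTransGen (GStep R.rules) s t)
    (hu : ReflTransGen (GStep R.rules) s u) :
    Join (ReflTransGen (GStep R.rules)) t u := by
  have hvars : ∀ ρ ∈ R.rules, vars ρ.2 ⊆ vars ρ.1 := fun ρ hρ => (R.isRule ρ hρ).vars_subset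
  -- Only the finitely many variables of `s` matter: they embed into `V`, and since steps create no
  -- variables the renaming can be undone on every reduct.
  obtain ⟨ρ, -, hρ⟩ := (vars_finite s).exists_injOn_of_encard_le
    (t := (Set.univ : Set V)) (by simp [Set.encard_eq_top Set.infinite_univ])
  have hback : ∀ q : L.Term X, vars q ⊆ vars s →
      (q.subst fun x => .var (ρ x)).subst
        (fun v => (.var (Function.invFunOn ρ (vars s) v) : L.Term X)) = q := fun q hq => by
    rw [subst_subst]
    conv_rhs => rw [← subst_var q]
    exact subst_congr fun x hx => congrArg Term.var (hρ.leftInvOn_invFunOn (hq hx))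
  obtain ⟨w, h₁, h₂⟩ := hR _ ((funs_relabel s ρ).trans_subset hs) _ _
    (gstep_reflTransGen_step subset_rfl (gstep_reflTransGen_subst ht _))
    (gstep_reflTransGen_step subset_rfl (gstep_reflTransGen_subst hu _))
  refine ⟨w.subst fun v => .var (Function.invFunOn ρ (vars s) v), ?_, ?_⟩
  · have h := gstep_reflTransGen_subst (ReflTransGen.mono (fun _ _ h => h.gstep) _ _ h₁)
      fun v => (.var (Function.invFunOn ρ (vars s) v) : L.Term X)
    rwa [hback t (gstep_vars_subset_of_reflTransGen hvars ht)] at h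
  · have h := gstep_reflTransGen_subst (ReflTransGen.mono (fun _ _ h => h.gstep) _ _ h₂)
      fun v => (.var (Function.invFunOn ρ (vars s) v) : L.Term X)
    rwa [hback u (gstep_vars_subset_of_reflTransGen hvars hu)] at h

/-! ### Reductions of terms -/

theorem step_func_cases {n : ℕ} {f : L.Functions n} {ts : Fin n → L.Term V} {s : L.Term V}
    (h : Step P (.func f ts) s) :
    (∃ l r σ, (l, r) ∈ P ∧ l.subst σ = .func f ts ∧ r.subst σ = s) ∨
      ∃ i t, Step P (ts i) t ∧ s = .func f (Function.update ts i t) := by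
  generalize hq : Term.func f ts = q at h
  cases h with
  | root h σ => exact .inl ⟨_, _, σ, h, rfl, rfl⟩
  | arg g us i h => cases hq; exact .inr ⟨i, _, h, rfl⟩

/-- The arguments are reduced one at a time; the induction is on the set of positions already done.
-/
theorem red_func {n : ℕ} (f : L.Functions n) {ts us : Fin n → L.Term V}
    (h : ∀ i, ReflTransGen (Step P) (ts i) (us i)) :
    ReflTransGen (Step P) (.func f ts) (.func f us) := by
  classical
  have key : ∀ S : Finset (Fin n), ReflTransGen (Step P) (.func f ts)
      (.func f fun i => if i ∈ S then us i else ts i) := by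
    intro S
    induction S using Finset.induction_on with
    | empty => simpa using ReflTransGen.refl
    | insert a S ha ih =>
      refine ih.trans ?_
      set ws : Fin n → L.Term V := fun i => if i ∈ S then us i else ts i with hws
      have h₁ : (fun i => if i ∈ insert a S then us i else ts i) =
          Function.update ws a (us a) := by
        funext i
        by_cases hi : i = a
        · subst hi; simp
        · simp [hi, hws]
      have h₂ : ws = Function.update ws a (ts a) := by
        funext i
        by_cases hi : i = a
        · subst hi; simp [hws, ha]
        · simp [hi]
      rw [h₁]
      conv_lhs => rw [h₂]
      refine (h a).lift (fun q => Term.func f (Function.update ws a q)) fun p q hpq => ?_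
      have := Step.arg f (Function.update ws a p) a (t := q) (by simpa using hpq)
      simpa using this
  simpa using key Finset.univ

theorem red_subst (t : L.Term X) {σ τ : X → L.Term V}
    (h : ∀ x ∈ vars t, ReflTransGen (Step P) (σ x) (τ x)) :
    ReflTransGen (Step P) (t.subst σ) (t.subst τ) := by
  induction t with
  | var x => exact h x rfl
  | func f ts ih =>
    exact red_func f fun i => ih i fun x hx => h x (Set.mem_iUnion_of_mem i hx)

/-- Two terms have a common reduct. -/
abbrev Joinable (P : Set (L.Term V × L.Term V)) (s t : L.Term V) : Prop :=
  Join (ReflTransGen (Step P)) s t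

/-- Any two reducts of the term have a common reduct. -/
def ConfluentAt (P : Set (L.Term V × L.Term V)) (s : L.Term V) : Prop :=
  ∀ ⦃t u⦄, ReflTransGen (Step P) s t → ReflTransGen (Step P) s u → Joinable P t u

theorem Joinable.symm {s t : L.Term V} (h : Joinable P s t) : Joinable P t s :=
  let ⟨w, h₁, h₂⟩ := h
  ⟨w, h₂, h₁⟩

theorem Joinable.trans {s t u : L.Term V} (ht : ConfluentAt P t) (h₁ : Joinable P s t)
    (h₂ : Joinable P t u) : Joinable P s u :=
  let ⟨_, hs, ht₁⟩ := h₁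
  let ⟨_, ht₂, hu⟩ := h₂
  let ⟨w, h₃, h₄⟩ := ht ht₁ ht₂
  ⟨w, hs.trans h₃, hu.trans h₄⟩

theorem ConfluentAt.red {s t : L.Term V} (hs : ConfluentAt P s)
    (h : ReflTransGen (Step P) s t) : ConfluentAt P t :=
  fun _ _ h₁ h₂ => hs (h.trans h₁) (h.trans h₂)

theorem joinable_subst (t : L.Term X) {σ τ : X → L.Term V}
    (h : ∀ x ∈ vars t, Joinable P (σ x) (τ x)) : Joinable P (t.subst σ) (t.subst τ) := by
  classical
  choose ρ h₁ h₂ using h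
  refine ⟨t.subst fun x => if hx : x ∈ vars t then ρ x hx else σ x, red_subst t ?_,
    red_subst t ?_⟩ <;> intro x hx <;> simp only [hx, dif_pos]
  exacts [h₁ x hx, h₂ x hx]

theorem exists_common_reduct [Nonempty V] {S : Set (L.Term V)} (hS : S.Finite)
    (hconf : ∀ s ∈ S, ConfluentAt P s) (hjoin : ∀ s ∈ S, ∀ t ∈ S, Joinable P s t) :
    ∃ w, ∀ s ∈ S, ReflTransGen (Step P) s w := by
  induction S, hS using Set.Finite.induction_on with
  | empty => exact ⟨.var (Classical.arbitrary V), by simp⟩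
  | @insert a S ha hS ih =>
    obtain ⟨w, hw⟩ := ih (fun s hs => hconf s (.inr hs))
      fun s hs t ht => hjoin s (.inr hs) t (.inr ht)
    rcases S.eq_empty_or_nonempty with rfl | ⟨s, hs⟩
    · exact ⟨a, by simpa using ReflTransGen.refl⟩
    -- One element `s` of the old set links `a` to the old common reduct `w`: both meet above
    -- reducts of `s`, and `s` is confluent.
    · obtain ⟨e, h₁, h₂⟩ := hjoin a (.inl rfl) s (.inr hs)
      obtain ⟨d, h₃, h₄⟩ := hconf s (.inr hs) h₂ (hw s hs)
      refine ⟨d, ?_⟩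
      rintro t (rfl | ht)
      · exact h₁.trans h₃
      · exact (hw t ht).trans h₄

/-! ### Layers -/

variable {F G : Set (Symbol L)}

/-- A term over `F` whose subterms rooted in a symbol of `G` are ground. With aliens for variables,
such terms serve as the top layers of terms over `F ∪ G`. -/
def Lay (F G : Set (Symbol L)) : L.Term X → Prop
  | .var _ => True
  | .func (l := n) f ts => (⟨n, f⟩ : Symbol L) ∈ F ∧ (∀ i, Lay F G (ts i)) ∧
      ((⟨n, f⟩ : Symbol L) ∈ G → ∀ i, vars (ts i) = ∅)

theorem Lay.subst {C : L.Term X} (hC : Lay F G C) {σ : X → L.Term Y}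
    (hσ : ∀ x ∈ vars C, Lay F G (σ x)) : Lay F G (C.subst σ) := by
  induction C with
  | var x => exact hσ x rfl
  | func f ts ih =>
    refine ⟨hC.1, fun i => ih i (hC.2.1 i) fun x hx => hσ x (Set.mem_iUnion_of_mem i hx),
      fun hf i => ?_⟩
    rw [vars_subst, hC.2.2 hf i, Set.biUnion_empty]

theorem Lay.relabel {C : L.Term X} (hC : Lay F G C) (ρ : X → Y) :
    Lay F G (C.subst fun x => .var (ρ x)) :=
  hC.subst fun _ _ => trivial

theorem Lay.of_subst {C : L.Term X} {σ : X → L.Term Y} (hC : Lay F G (C.subst σ)) {x : X}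
    (hx : x ∈ vars C) : Lay F G (σ x) := by
  induction C with
  | var y => cases hx; exact hC
  | func f ts ih =>
    obtain ⟨i, hi⟩ := Set.mem_iUnion.1 hx
    exact ih i (hC.2.1 i) hi

theorem Lay.funs_subset {C : L.Term X} (hC : Lay F G C) : funs C ⊆ F := by
  induction C with
  | var x => exact Set.empty_subset F
  | func f ts ih =>
    exact Set.insert_subset hC.1 (Set.iUnion_subset fun i => ih i (hC.2.1 i))

theorem Lay.subst_mem_groundTerms {C : L.Term X} (hC : Lay F G C) (hv : vars C = ∅)
    (σ : X → L.Term V) : C.subst σ ∈ groundTerms V F := by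
  refine ⟨(hC.subst (Y := V) (σ := σ) fun x hx => ?_).funs_subset, ?_⟩
  · simp [hv] at hx
  · rw [vars_subst, hv, Set.biUnion_empty]

theorem vars_func_eq_empty {n : ℕ} {f : L.Functions n} {ts : Fin n → L.Term X} :
    vars (.func f ts) = ∅ ↔ ∀ i, vars (ts i) = ∅ :=
  Set.iUnion_eq_empty

theorem lay_of_quasiGround {t : L.Term V} (ht : t ∈ termsOver V F) (hq : QuasiGround F G t) :
    Lay F G t := by
  induction t with
  | var x => trivial
  | func f ts ih =>
    refine ⟨ht (Set.mem_insert _ _), fun i => ih i ?_ fun s hs => hq s (.arg f ts i hs),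
      fun hf => vars_func_eq_empty.1 (hq _ (.refl _) ⟨ht (Set.mem_insert _ _), hf⟩).2⟩
    exact fun y hy => ht (.inr (Set.mem_iUnion_of_mem i hy))

/-- The terms that are not built from a top layer: variables, terms whose root is not in `F`, and
terms whose root is a shared symbol, unless they are ground over `F`. -/
def Alien (F G : Set (Symbol L)) : L.Term V → Prop
  | .var _ => True
  | .func (l := n) f ts => (⟨n, f⟩ : Symbol L) ∈ F →
      (⟨n, f⟩ : Symbol L) ∈ G ∧ ∃ i, ts i ∉ groundTerms V F

open Classical in
/-- The top layer of a term, with the aliens below it as variables. -/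
noncomputable def top (F G : Set (Symbol L)) : L.Term V → L.Term (L.Term V)
  | .var x => .var (.var x)
  | .func f ts => if Alien F G (.func f ts) then .var (.func f ts) else
      .func f fun i => top F G (ts i)

theorem top_of_alien {t : L.Term V} (h : Alien F G t) : top F G t = .var t := by
  cases t with
  | var x => rfl
  | func f ts => exact if_pos h

theorem top_func {n : ℕ} {f : L.Functions n} {ts : Fin n → L.Term V}
    (h : ¬ Alien F G (.func f ts)) : top F G (.func f ts) = .func f fun i => top F G (ts i) :=
  if_neg h

theorem top_subst_id (t : L.Term V) : (top F G t).subst id = t := by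
  induction t with
  | var x => rfl
  | func f ts ih =>
    by_cases h : Alien F G (.func f ts)
    · rw [top_of_alien h]; rfl
    · rw [top_func h]
      simp only [Term.subst, ih]

/-- No function position of a layer becomes an alien under substitution, because the arguments of a
shared symbol in it are already ground. This is where quasi-groundness enters. -/
theorem top_subst {C : L.Term X} (hC : Lay F G C) (σ : X → L.Term V) :
    top F G (C.subst σ) = C.subst fun x => top F G (σ x) := by
  induction C with
  | var x => rfl
  | func f ts ih =>
    have h : ¬ Alien F G ((Term.func f ts).subst σ) := fun h =>
      let ⟨hG, i, hi⟩ := h hC.1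
      hi ((hC.2.1 i).subst_mem_groundTerms (hC.2.2 hG i) σ)
    exact (top_func h).trans (congrArg _ (funext fun i => ih i (hC.2.1 i)))

/-- A decomposition into a layer and aliens is unique. -/
theorem top_subst_id_of_alien {C : L.Term (L.Term V)} (hC : Lay F G C)
    (h : ∀ a ∈ vars C, Alien F G a) : top F G (C.subst id) = C := by
  rw [top_subst hC]
  conv_rhs => rw [← subst_var C]
  exact subst_congr fun a ha => top_of_alien (h a ha)

theorem not_alien_func {n : ℕ} {f : L.Functions n} {ts : Fin n → L.Term V}
    (h : ¬ Alien F G (.func f ts)) : (⟨n, f⟩ : Symbol L) ∈ F ∧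
      ((⟨n, f⟩ : Symbol L) ∈ G → ∀ i, ts i ∈ groundTerms V F) := by
  simp only [Alien] at h
  push Not at h
  exact h

theorem vars_top_of_mem_groundTerms {t : L.Term V} (ht : t ∈ groundTerms V F) :
    vars (top F G t) = ∅ := by
  induction t with
  | var x => exact absurd ht.2 (Set.singleton_ne_empty x)
  | func f ts ih =>
    have hg : ∀ i, ts i ∈ groundTerms V F := fun i =>
      ⟨fun y hy => ht.1 (.inr (Set.mem_iUnion_of_mem i hy)), vars_func_eq_empty.1 ht.2 i⟩
    have h : ¬ Alien F G (.func f ts) := fun h =>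
      let ⟨_, i, hi⟩ := h (ht.1 (Set.mem_insert _ _))
      hi (hg i)
    rw [top_func h]
    exact vars_func_eq_empty.2 fun i => ih i (hg i)

theorem lay_top (t : L.Term V) : Lay F G (top F G t) := by
  induction t with
  | var x => trivial
  | func f ts ih =>
    by_cases h : Alien F G (.func f ts)
    · rw [top_of_alien h]; trivial
    · rw [top_func h]
      obtain ⟨hf, hg⟩ := not_alien_func h
      exact ⟨hf, ih, fun hG i => vars_top_of_mem_groundTerms (hg hG i)⟩

theorem alien_of_mem_vars_top {t a : L.Term V} (ha : a ∈ vars (top F G t)) : Alien F G a := by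
  induction t with
  | var x => cases ha; trivial
  | func f ts ih =>
    by_cases h : Alien F G (.func f ts)
    · rw [top_of_alien h] at ha; cases ha; exact h
    · rw [top_func h] at ha
      obtain ⟨i, hi⟩ := Set.mem_iUnion.1 ha
      exact ih i hi

theorem vars_top_subset {K : Set (L.Term V)}
    (hK : ∀ {n} {f : L.Functions n} {ts : Fin n → L.Term V}, .func f ts ∈ K → ∀ i, ts i ∈ K)
    {t : L.Term V} (ht : t ∈ K) : vars (top F G t) ⊆ K := by
  induction t with
  | var x => exact Set.singleton_subset_iff.2 ht
  | func f ts ih =>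
    by_cases h : Alien F G (.func f ts)
    · rw [top_of_alien h]; exact Set.singleton_subset_iff.2 ht
    · rw [top_func h]
      exact Set.iUnion_subset fun i => ih i (hK ht i)

/-- The terms that consist of a top layer and, below it, terms from `M`. -/
def Layered (F G : Set (Symbol L)) (M : Set (L.Term V)) : Set (L.Term V) :=
  {t | ∃ C : L.Term (L.Term V), Lay F G C ∧ vars C ⊆ M ∧ C.subst id = t}

theorem subset_layered (M : Set (L.Term V)) : M ⊆ Layered F G M :=
  fun t ht => ⟨.var t, trivial, Set.singleton_subset_iff.2 ht, rfl⟩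

theorem Lay.subst_mem_layered {C : L.Term X} (hC : Lay F G C) {M : Set (L.Term V)}
    {σ : X → L.Term V} (hσ : ∀ x ∈ vars C, σ x ∈ Layered F G M) :
    C.subst σ ∈ Layered F G M := by
  classical
  choose D hD hv hs using hσ
  refine ⟨C.subst fun x => if hx : x ∈ vars C then D x hx else .var (σ x),
    hC.subst fun x hx => ?_, ?_, ?_⟩
  · simpa only [hx, dif_pos] using hD x hx
  · rw [vars_subst]
    refine Set.iUnion₂_subset fun x hx => ?_
    simpa only [hx, dif_pos] using hv x hx
  · rw [subst_subst]
    refine subst_congr fun x hx => ?_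
    simpa only [hx, dif_pos] using hs x hx

theorem mem_layered_of_groundTerms {t : L.Term V} (ht : t ∈ groundTerms V F)
    (M : Set (L.Term V)) : t ∈ Layered F G M :=
  ⟨top F G t, lay_top t, (vars_top_of_mem_groundTerms ht).trans_subset (Set.empty_subset M),
    top_subst_id t⟩

/-- The rules `A` over `F` are those rules of `P` that rewrite top layers over `F`, and they are
confluent. -/
structure Component (F G : Set (Symbol L)) (A P : Set (L.Term V × L.Term V)) : Prop where
  subset : A ⊆ P
  lay : ∀ ρ ∈ A, Lay F G ρ.1 ∧ Lay F G ρ.2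
  vars_subset : ∀ ρ ∈ A, vars ρ.2 ⊆ vars ρ.1
  mem_of_rootIn : ∀ ρ ∈ P, RootIn F ρ.1 → ρ ∈ A
  not_shared : ∀ ρ ∈ P, ¬ RootIn (F ∩ G) ρ.1
  ne_var : ∀ ρ ∈ P, ∀ x, ρ.1 ≠ .var x
  -- Sets of terms serve as variables because aliens will be replaced by their joinability classes.
  confluent : ∀ s t u : L.Term (Set (L.Term V)), funs s ⊆ F → ReflTransGen (GStep A) s t →
    ReflTransGen (GStep A) s u → Join (ReflTransGen (GStep A)) t u

theorem rootIn_subst {S : Set (Symbol L)} {t : L.Term V} (ht : ∀ x, t ≠ .var x)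
    (σ : V → L.Term X) : RootIn S (t.subst σ) ↔ RootIn S t := by
  cases t with
  | var x => exact absurd rfl (ht x)
  | func f ts => rfl

theorem Component.lay_gstep (H : Component F G A P) {C D : L.Term X} (hC : Lay F G C)
    (h : GStep A C D) : Lay F G D := by
  induction h with
  | root h σ =>
    exact (H.lay _ h).2.subst fun x hx => hC.of_subst (H.vars_subset _ h hx)
  | arg f ts i h ih =>
    have hi := ih (hC.2.1 i)
    refine ⟨hC.1, fun j => ?_, fun hG j => ?_⟩ <;> by_cases hj : j = i
    · subst hj; simpa using hi
    · simpa [hj] using hC.2.1 j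
    · subst hj
      have := (h.vars_subset H.vars_subset).trans_eq (hC.2.2 hG j)
      simpa using this
    · simpa [hj] using hC.2.2 hG j

/-- A step either takes place in the top layer or inside one of the aliens below it. -/
theorem Component.step_cases (H : Component F G A P) {C : L.Term (L.Term V)} (hC : Lay F G C)
    (hal : ∀ a ∈ vars C, Alien F G a) {s : L.Term V} (h : Step P (C.subst id) s) :
    (∃ D, GStep A C D ∧ D.subst id = s) ∨
      ∃ D a b, Lay F G D ∧ a ∈ vars C ∧ Step P a b ∧ vars D ⊆ insert b (vars C) ∧
        D.subst id = s ∧ ∀ {Z : Type (max u w)} (ρ : L.Term V → Z), ρ a = ρ b →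
          (C.subst fun x => .var (ρ x)) = (D.subst fun x => .var (ρ x) : L.Term Z) := by
  induction C generalizing s with
  | var a =>
    refine .inr ⟨.var s, a, s, trivial, rfl, h, ?_, rfl, fun ρ hρ => ?_⟩
    · exact Set.singleton_subset_iff.2 (Set.mem_insert _ _)
    · simp only [Term.subst, hρ]
  | @func n f ts ih =>
    rcases step_func_cases h with ⟨l, r, σ, hlr, hl, rfl⟩ | ⟨i, t, ht, rfl⟩
    -- A redex at the root of the layer uses a rule of `A`. Its left-hand side is itself a layer, so
    -- the layer of the redex is an instance of it and the rule applies there.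
    · have hroot : RootIn F l := by
        rw [← rootIn_subst (H.ne_var _ hlr) σ, hl]
        exact hC.1
      have hA := H.mem_of_rootIn _ hlr hroot
      refine .inl ⟨r.subst fun x => top F G (σ x), ?_, ?_⟩
      · rw [← top_subst_id_of_alien hC hal]
        have : (Term.func f ts).subst id = l.subst σ := hl.symm
        rw [this, top_subst (H.lay _ hA).1]
        exact .root hA _
      · rw [subst_subst]
        simp only [top_subst_id]
    · rcases ih i (hC.2.1 i) (fun a ha => hal a (Set.mem_iUnion_of_mem i ha)) ht with
        ⟨D, hD, rfl⟩ | ⟨D, a, b, hD, ha, hab, hvD, rfl, hρ⟩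
      · exact .inl ⟨_, .arg f ts i hD, subst_func_update f ts i D id⟩
      · refine .inr ⟨.func f (Function.update ts i D), a, b, ⟨hC.1, fun j => ?_, fun hG => ?_⟩,
          Set.mem_iUnion_of_mem i ha, hab, ?_, subst_func_update f ts i D id, fun ρ h => ?_⟩
        · by_cases hj : j = i
          · subst hj; simpa using hD
          · simpa [hj] using hC.2.1 j
        -- Below a shared symbol a layer has no variables, so no alien can be there.
        · rw [hC.2.2 hG i] at ha
          exact ha.elim
        · refine Set.iUnion_subset fun j x hx => ?_
          by_cases hj : j = i
          · subst hj
            rcases hvD (by simpa using hx) with rfl | hx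
            · exact .inl rfl
            · exact .inr (Set.mem_iUnion_of_mem j hx)
          · exact .inr (Set.mem_iUnion_of_mem j (by simpa [hj] using hx))
        -- `D` is `C` with one occurrence of `a` turned into `b`, so identifying `a` with `b` makes
        -- them equal.
        · rw [subst_func_update, ← hρ ρ h]
          simp [Term.subst]

/-! ### Confluence of layers over confluent terms -/

/-- The terms all of whose reducts are aliens. -/
def StableAliens (F G : Set (Symbol L)) (P : Set (L.Term V × L.Term V)) : Set (L.Term V) :=
  {a | ∀ b, ReflTransGen (Step P) a b → Alien F G b}

/-- The set of terms that have a common reduct with a given term. -/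
def joinClass (P : Set (L.Term V × L.Term V)) (a : L.Term V) : Set (L.Term V) :=
  {c | Joinable P c a}

/-- This makes steps inside confluent aliens invisible in `classTerm`. -/
theorem joinClass_eq_of_step {a b : L.Term V} (ha : ConfluentAt P a) (h : Step P a b) :
    joinClass P a = joinClass P b := by
  ext c
  constructor
  · rintro ⟨d, h₁, h₂⟩
    obtain ⟨e, h₃, h₄⟩ := ha h₂ (.single h)
    exact ⟨e, h₁.trans h₃, h₄⟩
  · rintro ⟨d, h₁, h₂⟩
    exact ⟨d, h₁, h₂.head h⟩

theorem joinable_of_joinClass_eq {a b : L.Term V} (h : joinClass P a = joinClass P b) :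
    Joinable P a b :=
  (h ▸ ⟨a, .refl, .refl⟩ : a ∈ joinClass P b)

/-- The term with each variable replaced by its class of joinable terms. -/
def classTerm (P : Set (L.Term V × L.Term V)) (C : L.Term (L.Term V)) :
    L.Term (Set (L.Term V)) :=
  C.subst fun a => .var (joinClass P a)

/-- A finite set of confluent terms has a choice of reducts that identifies joinable terms. -/
theorem exists_section [Nonempty V] {S : Set (L.Term V)} (hS : S.Finite)
    (hconf : ∀ s ∈ S, ConfluentAt P s) :
    ∃ g : Set (L.Term V) → L.Term V, ∀ s ∈ S, ReflTransGen (Step P) s (g (joinClass P s)) := by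
  have h : ∀ p : Set (L.Term V), ∃ w, ∀ s ∈ {s ∈ S | joinClass P s = p},
      ReflTransGen (Step P) s w := fun p =>
    exists_common_reduct (hS.subset (Set.sep_subset _ _)) (fun s hs => hconf s hs.1)
      fun s hs t ht => joinable_of_joinClass_eq (hs.2.trans ht.2.symm)
  choose g hg using h
  exact ⟨g, fun s hs => hg _ s ⟨hs, rfl⟩⟩

variable {N : Set (L.Term V)}

/-- A layer step gives one step between the class terms, an alien step gives equal class terms.
Stability keeps the variables of the new layer aliens, so the argument can be iterated. -/
theorem Component.layered_step (H : Component F G A P) (hN : N ⊆ StableAliens F G P)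
    (hstep : ∀ a ∈ N, ∀ b, Step P a b → b ∈ N) (hconf : ∀ a ∈ N, ConfluentAt P a)
    {C : L.Term (L.Term V)} (hC : Lay F G C) (hv : vars C ⊆ N) {s : L.Term V}
    (h : Step P (C.subst id) s) :
    ∃ D, Lay F G D ∧ vars D ⊆ N ∧ D.subst id = s ∧
      ReflTransGen (GStep A) (classTerm P C) (classTerm P D) := by
  rcases H.step_cases hC (fun a ha => hN (hv ha) a .refl) h with
    ⟨D, hD, rfl⟩ | ⟨D, a, b, hD, ha, hab, hvD, rfl, hρ⟩
  · exact ⟨D, H.lay_gstep hC hD, (hD.vars_subset H.vars_subset).trans hv, rfl,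
      .single (hD.subst _)⟩
  · refine ⟨D, hD, hvD.trans (Set.insert_subset (hstep a (hv ha) b hab) hv), rfl, ?_⟩
    rw [classTerm, hρ _ (joinClass_eq_of_step (hconf a (hv ha)) hab)]
    exact .refl

theorem Component.layered_red (H : Component F G A P) (hN : N ⊆ StableAliens F G P)
    (hstep : ∀ a ∈ N, ∀ b, Step P a b → b ∈ N) (hconf : ∀ a ∈ N, ConfluentAt P a)
    {C : L.Term (L.Term V)} (hC : Lay F G C) (hv : vars C ⊆ N) {s : L.Term V}
    (h : ReflTransGen (Step P) (C.subst id) s) :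
    ∃ D, Lay F G D ∧ vars D ⊆ N ∧ D.subst id = s ∧
      ReflTransGen (GStep A) (classTerm P C) (classTerm P D) := by
  induction h with
  | refl => exact ⟨C, hC, hv, rfl, .refl⟩
  | tail _ h ih =>
    obtain ⟨D, hD, hvD, rfl, hCD⟩ := ih
    obtain ⟨E, hE, hvE, hs, hDE⟩ := H.layered_step hN hstep hconf hD hvD h
    exact ⟨E, hE, hvE, hs, hCD.trans hDE⟩

theorem Component.confluentAt_of_stable [Nonempty V] (H : Component F G A P)
    (hN : N ⊆ StableAliens F G P) (hstep : ∀ a ∈ N, ∀ b, Step P a b → b ∈ N)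
    (hconf : ∀ a ∈ N, ConfluentAt P a) {s : L.Term V} (hs : s ∈ Layered F G N) :
    ConfluentAt P s := by
  rintro t u ht hu
  obtain ⟨C, hC, hv, rfl⟩ := hs
  obtain ⟨D, hD, hvD, rfl, hCD⟩ := H.layered_red hN hstep hconf hC hv ht
  obtain ⟨E, hE, hvE, rfl, hCE⟩ := H.layered_red hN hstep hconf hC hv hu
  obtain ⟨W, hDW, hEW⟩ := H.confluent _ _ _ (hC.relabel _).funs_subset hCD hCE
  -- `g` assigns to each class one common reduct of the aliens of `D` and `E` in it, so both sides
  -- reach the same instance of `W`.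
  obtain ⟨g, hg⟩ := exists_section ((vars_finite D).union (vars_finite E))
    fun a ha => hconf a (Set.union_subset hvD hvE ha)
  have key : ∀ D : L.Term (L.Term V),
      (∀ a ∈ vars D, ReflTransGen (Step P) a (g (joinClass P a))) →
      ReflTransGen (GStep A) (classTerm P D) W →
      ReflTransGen (Step P) (D.subst id) (W.subst g) := fun D hg hDW => by
    refine (red_subst D hg).trans ?_
    have := gstep_reflTransGen_step H.subset (gstep_reflTransGen_subst hDW g)
    rwa [classTerm, subst_subst] at this
  exact ⟨W.subst g, key D (fun a ha => hg a (.inl ha)) hDW, key E (fun a ha => hg a (.inr ha)) hEW⟩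

/-- The set is closed under arguments and rewriting and consists of confluent terms. -/
structure IsConfluentClass (P : Set (L.Term V × L.Term V)) (K : Set (L.Term V)) : Prop where
  arg : ∀ {n : ℕ} {f : L.Functions n} {ts : Fin n → L.Term V}, .func f ts ∈ K → ∀ i, ts i ∈ K
  step : ∀ {a b}, a ∈ K → Step P a b → b ∈ K
  confluentAt : ∀ {a}, a ∈ K → ConfluentAt P a

theorem IsConfluentClass.red {K : Set (L.Term V)} (hK : IsConfluentClass P K) {a b : L.Term V}
    (ha : a ∈ K) (h : ReflTransGen (Step P) a b) : b ∈ K := by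
  induction h with
  | refl => exact ha
  | tail _ h ih => exact hK.step ih h

/-- Each term of `K` has a reduct whose aliens never fuse with the layer above them. -/
def Stabilizes (F G : Set (Symbol L)) (P : Set (L.Term V × L.Term V)) (K : Set (L.Term V)) :
    Prop :=
  ∀ a ∈ K, ∃ b ∈ Layered F G (StableAliens F G P), ReflTransGen (Step P) a b

theorem vars_top_subset_of_mem_layered {K : Set (L.Term V)} (hK : IsConfluentClass P K) {s : L.Term V}
    (hs : s ∈ Layered F G K) : vars (top F G s) ⊆ K := by
  obtain ⟨C, hC, hv, rfl⟩ := hs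
  rw [top_subst hC, vars_subst]
  exact Set.iUnion₂_subset fun a ha => vars_top_subset hK.arg (hv ha)

/-- Each term `s` reduces to the representative obtained by applying `rep` to its aliens.
Representatives have stable aliens and are therefore confluent, and along any reduction they stay
joinable, so a peak from `s` closes through them. -/
theorem Component.layered_confluent [Nonempty V] (H : Component F G A P) {K : Set (L.Term V)}
    (hK : IsConfluentClass P K) (hst : Stabilizes F G P K) :
    ∀ s ∈ Layered F G K, (∀ t, Step P s t → t ∈ Layered F G K) ∧ ConfluentAt P s := by
  classical
  set N := K ∩ StableAliens F G P with hNdef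
  have hN : N ⊆ StableAliens F G P := Set.inter_subset_right
  have hstep : ∀ a ∈ N, ∀ b, Step P a b → b ∈ N := fun a ha b hab =>
    ⟨hK.step ha.1 hab, fun c hbc => ha.2 c (hbc.head hab)⟩
  have hconf : ∀ a ∈ N, ConfluentAt P a := fun a ha => hK.confluentAt ha.1
  have hrep : ∀ a : L.Term V, ∃ b, a ∈ K → b ∈ Layered F G N ∧ ReflTransGen (Step P) a b := by
    intro a
    by_cases ha : a ∈ K
    · obtain ⟨b, hb, hab⟩ := hst a ha
      refine ⟨b, fun _ => ⟨⟨top F G b, lay_top b, Set.subset_inter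
        (vars_top_subset hK.arg (hK.red ha hab)) ?_, top_subst_id b⟩, hab⟩⟩
      obtain ⟨C, hC, hv, rfl⟩ := hb
      rwa [top_subst_id_of_alien hC fun a ha => hv ha a .refl]
    · exact ⟨a, fun h => absurd h ha⟩
  choose rep hrep using hrep
  have hconfN : ∀ {s}, s ∈ Layered F G N → ConfluentAt P s :=
    H.confluentAt_of_stable hN hstep hconf
  have hmem : ∀ {C : L.Term (L.Term V)}, Lay F G C → vars C ⊆ K →
      C.subst rep ∈ Layered F G N := fun hC hv =>
    hC.subst_mem_layered fun a ha => (hrep a (hv ha)).1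
  -- The representative of a term does not depend on its decomposition.
  have hdec : ∀ {D : L.Term (L.Term V)}, Lay F G D → vars D ⊆ K →
      Joinable P (D.subst rep) ((top F G (D.subst id)).subst rep) := fun {D} hD hv => by
    rw [top_subst hD, subst_subst]
    refine joinable_subst D fun a ha => hK.confluentAt (hv ha) (hrep a (hv ha)).2 ?_
    have := red_subst (P := P) (top F G a) (σ := id) (τ := rep)
      fun b hb => (hrep b (vars_top_subset hK.arg (hv ha) hb)).2
    rwa [top_subst_id] at this
  have hone : ∀ {s t}, s ∈ Layered F G K → Step P s t → t ∈ Layered F G K ∧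
      Joinable P ((top F G s).subst rep) ((top F G t).subst rep) := by
    intro s t hs h
    have hv := vars_top_subset_of_mem_layered hK hs
    rw [← top_subst_id (F := F) (G := G) s] at h
    -- A layer step is repeated on the representatives. In either case `hdec` accounts for `D`
    -- possibly not being the canonical decomposition.
    rcases H.step_cases (lay_top s) (fun a => alien_of_mem_vars_top) h with
      ⟨D, hD, rfl⟩ | ⟨D, a, b, hD, ha, hab, hvD, rfl, hρ⟩
    · have hDl := H.lay_gstep (lay_top s) hD
      have hvD := (hD.vars_subset H.vars_subset).trans hv
      refine ⟨⟨D, hDl, hvD, rfl⟩, ?_⟩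
      obtain ⟨w, h₁, h₂⟩ := hdec hDl hvD
      exact ⟨w, h₁.head ((hD.subst rep).step H.subset), h₂⟩
    · have hb := hK.step (hv ha) hab
      have hvD' := hvD.trans (Set.insert_subset hb hv)
      refine ⟨⟨D, hD, hvD', rfl⟩, ?_⟩
      -- Other occurrences of `a` may remain in `D`. Sending all of them to `rep b` makes the two
      -- layers agree, and `rep a` and `rep b` are joinable because `a` is confluent.
      set ρ := Function.update rep a (rep b) with hρdef
      have hjoin : ∀ c ∈ K, Joinable P (rep c) (ρ c) := by
        intro c hc
        by_cases hca : c = a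
        · subst hca
          simpa [hρdef] using hK.confluentAt hc (hrep c hc).2 ((hrep b hb).2.head hab)
        · rw [hρdef, Function.update_of_ne hca]
          exact ⟨rep c, .refl, .refl⟩
      have heq : (top F G s).subst ρ = D.subst ρ := by
        have hab' : ρ a = ρ b := by
          by_cases hba : b = a
          · rw [hba]
          · simp [hρdef, hba]
        have := congrArg (fun q => q.subst id) (hρ ρ hab')
        simpa only [subst_subst, Term.subst, id] using this
      refine Joinable.trans (hconfN (hmem hD hvD')) ?_ (hdec hD hvD')
      refine Joinable.trans (t := D.subst ρ) ?_ (heq ▸ joinable_subst _ fun c hc => hjoin c (hv hc))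
        (joinable_subst _ fun c hc => (hjoin c (hvD' hc)).symm)
      refine hconfN (hD.subst_mem_layered fun c hc => ?_)
      by_cases hca : c = a
      · subst hca; simpa [hρdef] using (hrep b hb).1
      · simpa [hρdef, hca] using (hrep c (hvD' hc)).1
  refine fun s hs => ⟨fun t h => (hone hs h).1, ?_⟩
  have hrepmem : ∀ {t}, t ∈ Layered F G K → (top F G t).subst rep ∈ Layered F G N := fun ht =>
    hmem (lay_top _) (vars_top_subset_of_mem_layered hK ht)
  have hmany : ∀ {t}, ReflTransGen (Step P) s t → t ∈ Layered F G K ∧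
      Joinable P ((top F G s).subst rep) ((top F G t).subst rep) := by
    intro t ht
    induction ht with
    | refl => exact ⟨hs, _, .refl, .refl⟩
    | tail _ h ih =>
      obtain ⟨h₁, h₂⟩ := hone ih.1 h
      exact ⟨h₁, Joinable.trans (hconfN (hrepmem ih.1)) ih.2 h₂⟩
  have hred : ∀ {t}, t ∈ Layered F G K → ReflTransGen (Step P) t ((top F G t).subst rep) :=
    fun {t} ht => by
      have := red_subst (P := P) (top F G t) (σ := id) (τ := rep)
        fun b hb => (hrep b (vars_top_subset_of_mem_layered hK ht hb)).2
      rwa [top_subst_id] at this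
  intro t u ht hu
  obtain ⟨ht, hst⟩ := hmany ht
  obtain ⟨hu, hsu⟩ := hmany hu
  obtain ⟨w, h₁, h₂⟩ := Joinable.trans (hconfN (hrepmem hs)) hst.symm hsu
  exact ⟨w, (hred ht).trans h₁, (hred hu).trans h₂⟩

theorem stabilizes_layered {K : Set (L.Term V)}
    (hst : Stabilizes F G P K) : Stabilizes F G P (Layered F G K) := by
  classical
  rintro s ⟨C, hC, hv, rfl⟩
  choose! rep h₁ h₂ using hst
  exact ⟨C.subst rep, hC.subst_mem_layered fun a ha => h₁ a (hv ha),
    red_subst C fun a ha => h₂ a (hv ha)⟩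

/-! ### The hierarchy of layered terms -/

theorem step_func_of_not_rootIn {n : ℕ} {f : L.Functions n} {ts : Fin n → L.Term V}
    {S : Set (Symbol L)} (hP : ∀ ρ ∈ P, ∀ x, ρ.1 ≠ .var x) (hS : ∀ ρ ∈ P, ¬ RootIn S ρ.1)
    (hf : (⟨n, f⟩ : Symbol L) ∈ S) {s : L.Term V} (h : Step P (.func f ts) s) :
    ∃ i t, Step P (ts i) t ∧ s = .func f (Function.update ts i t) := by
  rcases step_func_cases h with ⟨l, r, σ, hlr, hl, rfl⟩ | h
  · refine absurd ?_ (hS _ hlr)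
    rw [← rootIn_subst (hP _ hlr) σ, hl]
    exact hf
  · exact h

theorem not_step_var (hP : ∀ ρ ∈ P, ∀ x, ρ.1 ≠ .var x) {x : V} {s : L.Term V} :
    ¬ Step P (.var x) s := by
  intro h
  generalize hq : Term.var x = q at h
  cases h with
  | @root l r h σ =>
    cases l with
    | var y => exact hP _ h y rfl
    | func f ts => simp [Term.subst] at hq
  | arg f ts i h => cases hq

theorem red_func_of_not_rootIn {n : ℕ} {f : L.Functions n} {ts : Fin n → L.Term V}
    {S : Set (Symbol L)} (hP : ∀ ρ ∈ P, ∀ x, ρ.1 ≠ .var x) (hS : ∀ ρ ∈ P, ¬ RootIn S ρ.1)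
    (hf : (⟨n, f⟩ : Symbol L) ∈ S) {s : L.Term V}
    (h : ReflTransGen (Step P) (.func f ts) s) :
    ∃ us, (∀ i, ReflTransGen (Step P) (ts i) (us i)) ∧ s = .func f us := by
  induction h with
  | refl => exact ⟨ts, fun _ => .refl, rfl⟩
  | tail _ h ih =>
    obtain ⟨us, hus, rfl⟩ := ih
    obtain ⟨i, t, ht, rfl⟩ := step_func_of_not_rootIn hP hS hf h
    refine ⟨_, fun j => ?_, rfl⟩
    by_cases hj : j = i
    · subst hj; simpa using (hus j).tail ht
    · simpa [hj] using hus j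

/-- The terms over a shared symbol with arguments in `K`. -/
def SharedRoot (F G : Set (Symbol L)) (K : Set (L.Term V)) : Set (L.Term V) :=
  {t | ∃ (n : ℕ) (f : L.Functions n) (ts : Fin n → L.Term V), (⟨n, f⟩ : Symbol L) ∈ F ∩ G ∧
    (∀ i, ts i ∈ K) ∧ t = .func f ts}

theorem mem_layered_func {K : Set (L.Term V)} {n : ℕ} {f : L.Functions n}
    {ts : Fin n → L.Term V} (h : .func f ts ∈ Layered F G K) :
    .func f ts ∈ K ∨ (⟨n, f⟩ : Symbol L) ∈ F ∧ ∀ i, ts i ∈ Layered F G K := by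
  obtain ⟨C, hC, hv, hs⟩ := h
  cases C with
  | var a => exact .inl (hs ▸ hv rfl)
  | func g us =>
    cases hs
    exact .inr ⟨hC.1, fun i => ⟨us i, hC.2.1 i, (Set.subset_iUnion _ i).trans hv, rfl⟩⟩

theorem func_mem_groundTerms {n : ℕ} {f : L.Functions n} {ts : Fin n → L.Term V}
    (hf : (⟨n, f⟩ : Symbol L) ∈ F) (h : ∀ i, ts i ∈ groundTerms V F) :
    .func f ts ∈ groundTerms V F :=
  ⟨Set.insert_subset hf (Set.iUnion_subset fun i => (h i).1),
    vars_func_eq_empty.2 fun i => (h i).2⟩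

/-- A term stabilizes if each reduct with a function symbol at the root lies in a stabilizing set
or has its root in the other signature. -/
theorem exists_stable_reduct {K : Set (L.Term V)} (hst : Stabilizes F G P K) {a : L.Term V}
    (h : ∀ {n : ℕ} {f : L.Functions n} {ts : Fin n → L.Term V},
      ReflTransGen (Step P) a (.func f ts) → .func f ts ∈ K ∨ (⟨n, f⟩ : Symbol L) ∈ G) :
    ∃ b ∈ Layered F G (StableAliens F G P), ReflTransGen (Step P) a b := by
  by_cases ha : a ∈ StableAliens F G P
  · exact ⟨a, subset_layered _ ha, .refl⟩
  · simp only [StableAliens, Set.mem_ofPred_eq, not_forall] at ha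
    obtain ⟨b, hab, hb⟩ := ha
    cases b with
    | var x => exact absurd trivial hb
    | func f ts =>
      obtain ⟨hF, hg⟩ := not_alien_func hb
      rcases h hab with hK | hG
      · obtain ⟨c, hc, hbc⟩ := hst _ hK
        exact ⟨c, hc, hab.trans hbc⟩
      -- A term with a shared root that is not an alien is ground over `F`, hence a layer without
      -- aliens.
      · exact ⟨_, mem_layered_of_groundTerms (func_mem_groundTerms hF (hg hG)) _, hab⟩

/-- The terms built from `K` by a layer over either signature or by a shared symbol. -/
def NextClass (F G : Set (Symbol L)) (K : Set (L.Term V)) : Set (L.Term V) :=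
  Layered F G K ∪ Layered G F K ∪ SharedRoot F G K

theorem nextClass_comm (K : Set (L.Term V)) : NextClass F G K = NextClass G F K := by
  simp only [NextClass, SharedRoot, Set.inter_comm F G, Set.union_comm (Layered F G K)]

variable {B : Set (L.Term V × L.Term V)}

/-- The two layered parts are handled by `Component.layered_confluent`. A shared symbol at the root
is never rewritten, so there reductions and joins are made argument by argument. -/
theorem Component.isConfluentClass_nextClass [Nonempty V] (HF : Component F G A P)
    (HG : Component G F B P) {K : Set (L.Term V)} (hK : IsConfluentClass P K)
    (hF : Stabilizes F G P K) (hG : Stabilizes G F P K) :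
    IsConfluentClass P (NextClass F G K) where
  arg := by
    intro n f ts h i
    rcases h with (h | h) | ⟨_, _, _, -, h, heq⟩
    · refine .inl (.inl ?_)
      exact (mem_layered_func h).elim (fun h => subset_layered _ (hK.arg h i)) fun h => h.2 i
    · refine .inl (.inr ?_)
      exact (mem_layered_func h).elim (fun h => subset_layered _ (hK.arg h i)) fun h => h.2 i
    · cases heq
      exact .inl (.inl (subset_layered _ (h i)))
  step := by
    rintro a b ((h | h) | ⟨n, f, ts, hf, h, rfl⟩) hab
    · exact .inl (.inl ((HF.layered_confluent hK hF a h).1 b hab))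
    · exact .inl (.inr ((HG.layered_confluent hK hG a h).1 b hab))
    · obtain ⟨i, t, ht, rfl⟩ := step_func_of_not_rootIn HF.ne_var HF.not_shared hf hab
      refine .inr ⟨n, f, _, hf, fun j => ?_, rfl⟩
      by_cases hj : j = i
      · subst hj; simpa using hK.step (h j) ht
      · simpa [hj] using h j
  confluentAt := by
    rintro a ((h | h) | ⟨n, f, ts, hf, h, rfl⟩)
    · exact (HF.layered_confluent hK hF a h).2
    · exact (HG.layered_confluent hK hG a h).2
    · intro t u ht hu
      obtain ⟨ts₁, h₁, rfl⟩ := red_func_of_not_rootIn HF.ne_var HF.not_shared hf ht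
      obtain ⟨ts₂, h₂, rfl⟩ := red_func_of_not_rootIn HF.ne_var HF.not_shared hf hu
      choose ws h₃ h₄ using fun i => hK.confluentAt (h i) (h₁ i) (h₂ i)
      exact ⟨.func f ws, red_func f h₃, red_func f h₄⟩

/-- Under a layer over `F` it suffices to stabilize the aliens. A layer over `G` or a shared root
has only reducts that lie in `K` or have their root in `G`, as `exists_stable_reduct` requires. -/
theorem Component.stabilizes_nextClass [Nonempty V] (HG : Component G F B P)
    {K : Set (L.Term V)} (hK : IsConfluentClass P K)
    (hF : Stabilizes F G P K) (hG : Stabilizes G F P K) :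
    Stabilizes F G P (NextClass F G K) := by
  rintro a ((h | h) | ⟨n, f, ts, hf, h, rfl⟩)
  · exact stabilizes_layered hF a h
  · refine exists_stable_reduct hF fun hab => ?_
    have hb : ∀ {b}, ReflTransGen (Step P) a b → b ∈ Layered G F K := fun hab => by
      induction hab with
      | refl => exact h
      | tail _ hbc ih => exact (HG.layered_confluent hK hG _ ih).1 _ hbc
    exact (mem_layered_func (hb hab)).imp_right And.left
  · refine exists_stable_reduct hF fun hab => .inr ?_
    have hf' : (⟨n, f⟩ : Symbol L) ∈ G ∩ F := hf.symm
    obtain ⟨us, -, heq⟩ := red_func_of_not_rootIn HG.ne_var HG.not_shared hf' hab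
    cases heq
    exact hf.2

/-- The terms that are built from variables by at most `k` layers. -/
def rankClass (V : Type w) (F G : Set (Symbol L)) : ℕ → Set (L.Term V)
  | 0 => Set.range .var
  | k + 1 => NextClass F G (rankClass V F G k)

theorem rankClass_mono : Monotone (rankClass V F G) :=
  monotone_nat_of_le_succ fun _ _ h => .inl (.inl (subset_layered _ h))

theorem Component.rankClass_spec [Nonempty V] (HF : Component F G A P) (HG : Component G F B P)
    (k : ℕ) : IsConfluentClass P (rankClass V F G k) ∧ Stabilizes F G P (rankClass V F G k) ∧
      Stabilizes G F P (rankClass V F G k) := by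
  induction k with
  | zero =>
    have hred : ∀ {x : V} {b}, ReflTransGen (Step P) (.var x) b → b = .var x := fun h => by
      rcases h.cases_head with h | ⟨c, h, -⟩
      · exact h.symm
      · exact absurd h (not_step_var HF.ne_var)
    have hst : ∀ {F G : Set (Symbol L)}, Stabilizes F G P (rankClass V F G 0) := by
      rintro F G - ⟨x, rfl⟩
      exact ⟨_, subset_layered _ fun b hb => hred hb ▸ trivial, .refl⟩
    refine ⟨⟨?_, ?_, ?_⟩, hst, hst⟩
    · rintro n f ts ⟨x, hx⟩
      cases hx
    · rintro - b ⟨x, rfl⟩ h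
      exact absurd h (not_step_var HF.ne_var)
    · rintro - ⟨x, rfl⟩ t u ht hu
      rw [hred ht, hred hu]
      exact ⟨_, .refl, .refl⟩
  | succ k ih =>
    obtain ⟨hK, hF, hG⟩ := ih
    refine ⟨HF.isConfluentClass_nextClass HG hK hF hG, HG.stabilizes_nextClass hK hF hG, ?_⟩
    -- The other stabilization is the same statement with the signatures exchanged.
    rw [rankClass, nextClass_comm]
    exact HF.stabilizes_nextClass hK hG hF

theorem exists_mem_rankClass {t : L.Term V} (ht : t ∈ termsOver V (F ∪ G)) :
    ∃ k, t ∈ rankClass V F G k := by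
  induction t with
  | var x => exact ⟨0, x, rfl⟩
  | @func n f ts ih =>
    choose k hk using fun i => ih i fun y hy => ht (.inr (Set.mem_iUnion_of_mem i hy))
    -- The arguments are lifted to one common rank; the root symbol then costs one more.
    have hk' : ∀ i, ts i ∈ rankClass V F G (Finset.univ.sup k) := fun i =>
      rankClass_mono (Finset.le_sup (Finset.mem_univ i)) (hk i)
    refine ⟨Finset.univ.sup k + 1, ?_⟩
    have key : ∀ {F G : Set (Symbol L)} {K : Set (L.Term V)}, (⟨n, f⟩ : Symbol L) ∈ F →
        (⟨n, f⟩ : Symbol L) ∉ G → (∀ i, ts i ∈ K) → .func f ts ∈ Layered F G K :=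
      fun hF hG h => ⟨.func f fun i => .var (ts i),
        ⟨hF, fun _ => trivial, fun hG' => absurd hG' hG⟩,
        Set.iUnion_subset fun i => Set.singleton_subset_iff.2 (h i), rfl⟩
    by_cases hF : (⟨n, f⟩ : Symbol L) ∈ F <;> by_cases hG : (⟨n, f⟩ : Symbol L) ∈ G
    · exact .inr ⟨n, f, ts, ⟨hF, hG⟩, hk', rfl⟩
    · exact .inl (.inl (key hF hG hk'))
    · exact .inl (.inr (key hG hF hk'))
    · exact absurd (ht (Set.mem_insert _ _)) (by simp [hF, hG])

/-! ### Components from the hypotheses, and the theorem -/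

theorem component_of_confluent [Infinite V] {R : TRS L V} (hAP : R.rules ⊆ P)
    (hvar : ∀ ρ ∈ P, ∀ x, ρ.1 ≠ .var x) (hmem : ∀ ρ ∈ P, RootIn R.sig ρ.1 → ρ ∈ R.rules)
    (hroot : ∀ ρ ∈ P, ¬ RootIn (R.sig ∩ G) ρ.1)
    (hqg : ∀ ρ ∈ P, QuasiGround R.sig G ρ.1 ∧ QuasiGround R.sig G ρ.2) (hR : R.Confluent) :
    Component R.sig G R.rules P where
  subset := hAP
  lay ρ h := ⟨lay_of_quasiGround (R.isRule ρ h).lhs_mem (hqg ρ (hAP h)).1,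
    lay_of_quasiGround (R.isRule ρ h).rhs_mem (hqg ρ (hAP h)).2⟩
  vars_subset ρ h := (R.isRule ρ h).vars_subset
  mem_of_rootIn := hmem
  not_shared := hroot
  ne_var := hvar
  confluent _ _ _ hs ht hu := gstep_confluent hR hs ht hu

theorem quasiGround_comm {t : L.Term V} (h : QuasiGround F G t) : QuasiGround G F t :=
  fun s hs hr => by
    rw [Set.union_comm]
    rw [Set.inter_comm] at hr
    exact h s hs hr

theorem rootIn_of_isRule {l r : L.Term V} (h : IsRule F l r) : RootIn F l := by
  cases l with
  | var x => exact absurd rfl (h.lhs_ne_var x)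
  | func f ts => exact h.lhs_mem (Set.mem_insert _ _)

theorem rootIn_inter {t : L.Term V} (hF : RootIn F t) (hG : RootIn G t) : RootIn (F ∩ G) t := by
  cases t with
  | var x => exact hF
  | func f ts => exact ⟨hF, hG⟩

end Rewriting

theorem mainTheorem8 {L : FirstOrder.Language} {V : Type*} [Countable V] [Infinite V]
    (R₁ R₂ : Rewriting.TRS L V)
    (hroot : ∀ ρ ∈ (R₁ ∪ R₂).rules, ¬ Rewriting.RootIn (R₁.sig ∩ R₂.sig) ρ.1)
    (hqg : ∀ ρ ∈ (R₁ ∪ R₂).rules,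
      Rewriting.QuasiGround R₁.sig R₂.sig ρ.1 ∧ Rewriting.QuasiGround R₁.sig R₂.sig ρ.2)
    (h₁ : R₁.Confluent) (h₂ : R₂.Confluent) :
    (R₁ ∪ R₂).Confluent := by
  open Rewriting in
  have hvar : ∀ ρ ∈ (R₁ ∪ R₂).rules, ∀ x, ρ.1 ≠ .var x := fun ρ h =>
    ((R₁ ∪ R₂).isRule ρ h).lhs_ne_var
  have H₁ : Component R₁.sig R₂.sig R₁.rules (R₁ ∪ R₂).rules :=
    component_of_confluent Set.subset_union_left hvar
      -- A rule of `R₂` whose left-hand side has its root in the signature of `R₁` would have a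
      -- shared root.
      (fun ρ h hr => h.resolve_right fun h' =>
        hroot ρ h (rootIn_inter hr (rootIn_of_isRule (R₂.isRule ρ h')))) hroot hqg h₁
  have H₂ : Component R₂.sig R₁.sig R₂.rules (R₁ ∪ R₂).rules :=
    component_of_confluent Set.subset_union_right hvar
      (fun ρ h hr => h.resolve_left fun h' =>
        hroot ρ h (rootIn_inter (rootIn_of_isRule (R₁.isRule ρ h')) hr))
      (by simpa only [Set.inter_comm] using hroot)
      (fun ρ h => ⟨quasiGround_comm (hqg ρ h).1, quasiGround_comm (hqg ρ h).2⟩) h₂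
  intro s hs t u ht hu
  obtain ⟨k, hk⟩ := exists_mem_rankClass hs
  exact (H₁.rankClass_spec H₂ k).1.confluentAt hk ht hu
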